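/- Let $k$ be an algebraically closed field. By a variety over $k$ we mean a reduced scheme which is separated and of finite type over $k$ (not necessarily irreducible). An algebraic semigroup over $k$ is a variety $S$ over $k$ equipped with an associative morphism of $k$-schemes $\mu : S \times_k S \to S$; we write $xy = \mu(x,y)$ for $k$-rational points $x, y \in S(k)$. Then every nonempty algebraic semigroup $S$ over $k$ has an idempotent: there exists a $k$-rational point $e \in S(k)$ such that $ee = e$. -/

import Mathlib

universe u

open AlgebraicGeometry CategoryTheory MonoidalCategory CartesianMonoidalCategory

namespace AlgSemigroups

/-- A variety over `k`: a reduced scheme, separated and of finite type over `k`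
(not necessarily irreducible, and possibly empty). -/
structure IsVariety {k : Type u} [Field k] (X : Over (Spec (.of k))) : Prop where
  isReduced : IsReduced X.left
  isSeparated : IsSeparated X.hom
  locallyOfFiniteType : LocallyOfFiniteType X.hom
  quasiCompact : QuasiCompact X.hom

/-- An algebraic semigroup over `k`: a variety `S` over `k` with an associative morphism
of `k`-schemes `mul : S × S ⟶ S`. Here `⊗` is the product of `k`-schemes, i.e. the fibre
product over `Spec k`. -/
structure AlgebraicSemigroup (k : Type u) [Field k] where
  /-- The underlying `k`-scheme. -/
  S : Over (Spec (.of k))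
  isVariety : IsVariety S
  /-- The composition law. -/
  mul : S ⊗ S ⟶ S
  mul_assoc : (mul ▷ S) ≫ mul = (α_ S S S).hom ≫ (S ◁ mul) ≫ mul

namespace AlgebraicSemigroup

variable {k : Type u} [Field k]

/-- The `k`-rational points of `G`: the morphisms of `k`-schemes `Spec k ⟶ G`. -/
abbrev Point (G : AlgebraicSemigroup k) := 𝟙_ (Over (Spec (.of k))) ⟶ G.S

/-- The product `x y` of two points, obtained by composing `(x, y) : Spec k ⟶ S × S`
with the composition law. -/
noncomputable def pointMul (G : AlgebraicSemigroup k) (x y : G.Point) : G.Point :=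
  lift x y ≫ G.mul

/-- A point `e` is idempotent if `e e = e`. -/
def IsIdempotent (G : AlgebraicSemigroup k) (e : G.Point) : Prop :=
  G.pointMul e e = e

end AlgebraicSemigroup

end AlgSemigroups

namespace AlgSemigroups

open Topology TopologicalSpace

/-! By noetherianity the rational points contain a minimal nonempty closed subsemigroup `C`, and
minimality makes every `xC` dense in `C`. Hence `(x, y) ↦ (x, xy)` has dense image in `C × C`; by
Chevalley the image is constructible, so it contains a nonempty open set. Slicing that set at a
second coordinate `z` gives `exists_open_dvd`: `z ∈ yC` for all `y` in a nonempty open subset of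
`C`. As `zC` meets this subset, `zs = z` for some `s ∈ C`; the stabilizer of `z` in `C` is then all
of `C`, so `zz = z`. -/

theorem interior_frontier_of_isConstructible {X : Type*} [TopologicalSpace X] {s : Set X}
    (hs : IsConstructible s) : interior (frontier s) = ∅ := by
  induction hs using BooleanSubalgebra.closure_bot_sup_induction with
  | mem U hU =>
    rw [← frontier_compl]
    exact interior_frontier hU.1.isClosed_compl
  | bot => simp
  | sup s _ t _ hs ht =>
    have h : frontier (s ∪ t) ⊆ frontier s ∪ frontier t :=
      (frontier_union_subset s t).trans
        (Set.union_subset_union Set.inter_subset_left Set.inter_subset_right)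
    have h' := interior_union_isClosed_of_interior_empty (s := frontier s) isClosed_frontier ht
    exact Set.subset_empty_iff.mp ((interior_mono h).trans (by rw [h', hs]))
  | compl s _ hs => rwa [frontier_compl]

/-- A dense set with empty interior would have the whole space as frontier. -/
theorem interior_nonempty_of_isConstructible_of_dense {X : Type*} [TopologicalSpace X] [Nonempty X]
    {s : Set X} (hs : IsConstructible s) (hd : Dense s) : (interior s).Nonempty := by
  rw [Set.nonempty_iff_ne_empty]
  intro h
  have := interior_frontier_of_isConstructible hs
  rw [frontier, h, Set.sdiff_empty, hd.closure_eq, interior_univ] at this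
  exact Set.univ_nonempty.ne_empty this

theorem exists_isIdempotentElem_of_dense_translates {M : Type*} [Semigroup M] [TopologicalSpace M]
    [NoetherianSpace M] [T1Space M] [Nonempty M]
    (hl : ∀ a : M, Continuous (a * ·)) (hr : ∀ a : M, Continuous (· * a))
    (H : ∀ C : Set M, IsClosed C → C.Nonempty → (∀ x ∈ C, closure ((x * ·) '' C) = C) →
      ∃ z ∈ C, ∃ U : Set M, IsOpen U ∧ (U ∩ C).Nonempty ∧ ∀ y ∈ U ∩ C, ∃ c ∈ C, y * c = z) :
    ∃ e : M, IsIdempotentElem e := by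
  let T : Set (Closeds M) := {C | (C : Set M).Nonempty ∧ ∀ x ∈ C, ∀ y ∈ C, x * y ∈ C}
  obtain ⟨C, ⟨hne, hC⟩, hmin⟩ := wellFounded_lt.has_min T
    ⟨⊤, Set.univ_nonempty, fun _ _ _ _ => trivial⟩
  have hmin' (D : Set M) (hD : IsClosed D) (hDC : D ⊆ C) (hDne : D.Nonempty)
      (hDm : ∀ x ∈ D, ∀ y ∈ D, x * y ∈ D) : D = C := by
    by_contra hne'
    exact hmin ⟨D, hD⟩ ⟨hDne, hDm⟩ (lt_of_le_of_ne hDC fun h => hne' congr(($h : Set M)))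
  have htr : ∀ x ∈ (C : Set M), closure ((x * ·) '' (C : Set M)) = C := by
    intro x hx
    have hsub : (x * ·) '' (C : Set M) ⊆ C := by
      rintro _ ⟨y, hy, rfl⟩
      exact hC x hx y hy
    refine hmin' _ isClosed_closure (closure_minimal hsub C.isClosed)
      (hne.image _).closure fun a ha b hb => ?_
    -- Multiplication is only separately continuous, so the closure is taken in one factor at a
    -- time.
    have h1 : ∀ a ∈ (x * ·) '' (C : Set M), ∀ b ∈ closure ((x * ·) '' (C : Set M)),
        a * b ∈ closure ((x * ·) '' (C : Set M)) := by
      intro a ha b hb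
      refine map_mem_closure (hl a) hb ?_
      rintro _ ⟨c, hc, rfl⟩
      obtain ⟨d, hd, rfl⟩ := ha
      exact ⟨d * (x * c), hC _ hd _ (hC _ hx _ hc), (mul_assoc _ _ _).symm⟩
    have := map_mem_closure (hr b) ha (t := closure ((x * ·) '' (C : Set M)))
      fun a ha => h1 a ha b hb
    rwa [closure_closure] at this
  obtain ⟨z, hz, U, hU, ⟨u, huU, huC⟩, hdiv⟩ := H C C.isClosed hne htr
  obtain ⟨_, hvU, t, ht, rfl⟩ : (U ∩ (z * ·) '' (C : Set M)).Nonempty :=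
    mem_closure_iff.mp ((htr z hz).symm ▸ huC) U hU huU
  obtain ⟨c, hc, hzc⟩ := hdiv _ ⟨hvU, hC z hz t ht⟩
  -- The stabilizer of `z` is closed because points are closed, and contains `t * c`.
  have hstab := hmin' (C ∩ (z * ·) ⁻¹' {z}) (C.isClosed.inter (isClosed_singleton.preimage (hl z)))
    Set.inter_subset_left ⟨t * c, hC t ht c hc, by simpa [mul_assoc] using hzc⟩
    fun x hx y hy => ⟨hC x hx.1 y hy.1, by
      have h1 : z * x = z := hx.2
      have h2 : z * y = z := hy.2
      simp [← mul_assoc, h1, h2]⟩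
  exact ⟨z, (hstab.symm ▸ hz : z ∈ (C : Set M) ∩ (z * ·) ⁻¹' {z}).2⟩

section Points

variable {k : Type u} [Field k]

/-- The underlying topological point of a rational point. -/
noncomputable def pt {X : Over (Spec (.of k))} (p : 𝟙_ (Over (Spec (.of k))) ⟶ X) : X.left :=
  p.left (IsLocalRing.closedPoint k)

theorem pt_comp {X Y : Over (Spec (.of k))} (p : 𝟙_ (Over (Spec (.of k))) ⟶ X) (f : X ⟶ Y) :
    pt (p ≫ f) = f.left (pt p) :=
  Scheme.Hom.comp_apply p.left f.left _

theorem pt_comp_hom {X : Over (Spec (.of k))} (p : 𝟙_ (Over (Spec (.of k))) ⟶ X) :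
    (p.left ≫ X.hom : Spec (.of k) ⟶ Spec (.of k)) = 𝟙 _ :=
  Over.w p

variable [IsAlgClosed k] {X : Over (Spec (.of k))} [LocallyOfFiniteType X.hom]

theorem isClosed_pt (p : 𝟙_ (Over (Spec (.of k))) ⟶ X) : IsClosed {pt p} :=
  (pointEquivClosedPoint X.hom ⟨p.left, pt_comp_hom p⟩).2

theorem pt_injective : Function.Injective (pt (X := X)) := fun p q h =>
  Over.OverMorphism.ext (ext_of_apply_closedPoint_eq X.hom (pt_comp_hom p) (pt_comp_hom q) h)

theorem exists_pt_eq {x : X.left} (hx : IsClosed {x}) :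
    ∃ p : 𝟙_ (Over (Spec (.of k))) ⟶ X, pt p = x :=
  ⟨Over.homMk (pointOfClosedPoint X.hom x hx) (pointOfClosedPoint_comp X.hom x hx),
    pointOfClosedPoint_apply X.hom x hx _⟩

theorem exists_pt_mem {s : Set X.left} (hs : IsLocallyClosed s) (hne : s.Nonempty) :
    ∃ p : 𝟙_ (Over (Spec (.of k))) ⟶ X, pt p ∈ s := by
  have : JacobsonSpace X.left := LocallyOfFiniteType.jacobsonSpace X.hom
  obtain ⟨x, hxs, hx⟩ := nonempty_inter_closedPoints hne hs
  obtain ⟨p, rfl⟩ := exists_pt_eq hx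
  exact ⟨p, hxs⟩

end Points

section FiniteType

variable {k : Type u} [Field k] {X Y : Over (Spec (.of k))}

theorem noetherianSpace_left [LocallyOfFiniteType X.hom] [QuasiCompact X.hom] :
    NoetherianSpace X.left := by
  have := LocallyOfFiniteType.isLocallyNoetherian X.hom
  have : CompactSpace X.left :=
    (quasiCompact_iff_compactSpace (Y := Spec (.of k)) X.hom).mp ‹_›
  have : IsNoetherian X.left := { }
  infer_instance

theorem locallyOfFiniteType_tensor [LocallyOfFiniteType X.hom] [LocallyOfFiniteType Y.hom] :
    LocallyOfFiniteType (X ⊗ Y).hom := by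
  rw [Over.tensorObj_hom]
  infer_instance

theorem quasiCompact_tensor [QuasiCompact X.hom] [QuasiCompact Y.hom] :
    QuasiCompact (X ⊗ Y).hom := by
  rw [Over.tensorObj_hom]
  infer_instance

theorem isConstructible_image_left [LocallyOfFiniteType X.hom] [QuasiCompact X.hom]
    [LocallyOfFiniteType Y.hom] [QuasiCompact Y.hom] (f : X ⟶ Y) {s : Set X.left}
    (hs : IsClosed s) : IsConstructible (f.left '' s) := by
  have := noetherianSpace_left (X := X)
  have := noetherianSpace_left (X := Y)
  have := LocallyOfFiniteType.isLocallyNoetherian Y.hom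
  have : LocallyOfFiniteType (f.left ≫ Y.hom) := by rwa [Over.w f]
  have : LocallyOfFiniteType f.left := locallyOfFiniteType_of_comp f.left Y.hom
  refine f.left.isConstructible_image ?_
  rw [← isConstructible_compl]
  exact (NoetherianSpace.isCompact _).isConstructible hs.isOpen_compl

end FiniteType

namespace AlgebraicSemigroup

variable {k : Type u} [Field k] (G : AlgebraicSemigroup k)

theorem pointMul_assoc (x y z : G.Point) :
    G.pointMul (G.pointMul x y) z = G.pointMul x (G.pointMul y z) := by
  have h := lift (lift x y) z ≫= G.mul_assoc
  simpa [pointMul] using h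

noncomputable instance : Semigroup G.Point where
  mul := G.pointMul
  mul_assoc := G.pointMul_assoc

theorem mul_def (x y : G.Point) : x * y = lift x y ≫ G.mul := rfl

/-- The Zariski topology on the set of rational points. -/
noncomputable instance : TopologicalSpace G.Point := .induced pt inferInstance

theorem continuous_pt : Continuous (pt : G.Point → G.S.left) := continuous_induced_dom

theorem continuous_pt_lift_left (a : G.Point) :
    Continuous fun x : G.Point => (pt (lift a x) : (G.S ⊗ G.S).left) := by
  have h (x : G.Point) : lift a x = x ≫ lift (toUnit G.S ≫ a) (𝟙 G.S) := by
    ext1 <;> simp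
  simp_rw [h, pt_comp]
  exact (Scheme.Hom.continuous _).comp G.continuous_pt

theorem continuous_pt_lift_right (a : G.Point) :
    Continuous fun x : G.Point => (pt (lift x a) : (G.S ⊗ G.S).left) := by
  have h (x : G.Point) : lift x a = x ≫ lift (𝟙 G.S) (toUnit G.S ≫ a) := by
    ext1 <;> simp
  simp_rw [h, pt_comp]
  exact (Scheme.Hom.continuous _).comp G.continuous_pt

theorem continuous_mul_left (a : G.Point) : Continuous (a * ·) := by
  refine continuous_induced_rng.mpr ?_
  simp only [Function.comp_def, mul_def, pt_comp]
  exact (Scheme.Hom.continuous _).comp (G.continuous_pt_lift_left a)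

theorem continuous_mul_right (a : G.Point) : Continuous (· * a) := by
  refine continuous_induced_rng.mpr ?_
  simp only [Function.comp_def, mul_def, pt_comp]
  exact (Scheme.Hom.continuous _).comp (G.continuous_pt_lift_right a)

theorem noetherianSpace_point : NoetherianSpace G.Point := by
  have := G.isVariety.locallyOfFiniteType
  have := G.isVariety.quasiCompact
  have := noetherianSpace_left (X := G.S)
  exact IsInducing.noetherianSpace (i := pt) ⟨rfl⟩

variable [IsAlgClosed k]

theorem t1Space_point : T1Space G.Point := by
  have := G.isVariety.locallyOfFiniteType
  refine ⟨fun p => ?_⟩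
  rw [← Set.preimage_image_eq {p} pt_injective, Set.image_singleton]
  exact (isClosed_pt p).preimage G.continuous_pt

/-- If all left translates of a closed set `C` of rational points are dense in `C`, then some
element of `C` is right divisible by all elements of a nonempty open subset of `C`. -/
theorem exists_open_dvd {C : Set G.Point} (hC : IsClosed C) (hne : C.Nonempty)
    (htr : ∀ x ∈ C, closure ((x * ·) '' C) = C) :
    ∃ z ∈ C, ∃ U : Set G.Point, IsOpen U ∧ (U ∩ C).Nonempty ∧
      ∀ y ∈ U ∩ C, ∃ c ∈ C, y * c = z := by
  have := G.isVariety.locallyOfFiniteType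
  have := G.isVariety.quasiCompact
  have := locallyOfFiniteType_tensor (X := G.S) (Y := G.S)
  have := quasiCompact_tensor (X := G.S) (Y := G.S)
  have := noetherianSpace_left (X := G.S ⊗ G.S)
  obtain ⟨Z, hZ, rfl⟩ := isClosed_induced_iff.mp hC
  let W : Set (G.S ⊗ G.S).left := (fst G.S G.S).left ⁻¹' Z ∩ (snd G.S G.S).left ⁻¹' Z
  have hW : IsClosed W :=
    (hZ.preimage (Scheme.Hom.continuous _)).inter (hZ.preimage (Scheme.Hom.continuous _))
  have hmemW (x y : G.Point) : pt (lift x y) ∈ W ↔ pt x ∈ Z ∧ pt y ∈ Z := by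
    simp only [W, Set.mem_inter_iff, Set.mem_preimage, ← pt_comp, lift_fst, lift_snd]
  have hlift (q : 𝟙_ (Over (Spec (.of k))) ⟶ G.S ⊗ G.S) : ∃ x y : G.Point, q = lift x y :=
    ⟨q ≫ fst _ _, q ≫ snd _ _, by ext1 <;> simp⟩
  let φ : G.S ⊗ G.S ⟶ G.S ⊗ G.S := lift (fst _ _) G.mul
  have hφ (x y : G.Point) : φ.left (pt (lift x y)) = pt (lift x (x * y)) := by
    rw [← pt_comp]
    congr 1
    ext1 <;> simp [φ, mul_def]
  have hA := (isConstructible_image_left φ hW).preimage_of_isClosedEmbedding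
    hW.isClosedEmbedding_subtypeVal (NoetherianSpace.isCompact _)
  obtain ⟨x₀, hx₀⟩ := hne
  have : Nonempty W := ⟨_, (hmemW x₀ x₀).mpr ⟨hx₀, hx₀⟩⟩
  have hd : Dense ((Subtype.val : W → _) ⁻¹' (φ.left '' W)) := by
    rw [dense_iff_inter_open]
    -- It suffices to approximate a rational point `(y, c)`, moving only the second coordinate
    -- within `yC`.
    rintro _ ⟨O, hO, rfl⟩ ⟨⟨w, hwW⟩, hwO⟩
    obtain ⟨q, hqO, hqW⟩ := exists_pt_mem (hO.isLocallyClosed.inter hW.isLocallyClosed)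
      ⟨w, hwO, hwW⟩
    obtain ⟨y, c, rfl⟩ := hlift q
    obtain ⟨hy, hc⟩ := (hmemW y c).mp hqW
    obtain ⟨_, hbO, b, hb, rfl⟩ := mem_closure_iff.mp
      ((htr y hy).symm ▸ (show c ∈ pt ⁻¹' Z from hc)) _
      (hO.preimage (G.continuous_pt_lift_left y)) hqO
    have hyb : y * b ∈ pt ⁻¹' Z := htr y hy ▸ subset_closure ⟨b, hb, rfl⟩
    exact ⟨⟨_, (hmemW y (y * b)).mpr ⟨hy, hyb⟩⟩, hbO, _, (hmemW y b).mpr ⟨hy, hb⟩, hφ y b⟩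
  obtain ⟨⟨w, hwW⟩, hw⟩ := interior_nonempty_of_isConstructible_of_dense hA hd
  obtain ⟨_, hsub, ⟨V, hV, rfl⟩, hwV⟩ := mem_interior.mp hw
  obtain ⟨q, hqV, hqW⟩ := exists_pt_mem (hV.isLocallyClosed.inter hW.isLocallyClosed) ⟨w, hwV, hwW⟩
  obtain ⟨y₀, z, rfl⟩ := hlift q
  obtain ⟨hy₀, hz⟩ := (hmemW y₀ z).mp hqW
  refine ⟨z, hz, _, hV.preimage (G.continuous_pt_lift_right z), ⟨y₀, hqV, hy₀⟩, ?_⟩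
  rintro y ⟨hyV, hy⟩
  obtain ⟨v, hvW, hv⟩ := @hsub ⟨_, (hmemW y z).mpr ⟨hy, hz⟩⟩ hyV
  -- The preimage `v` need not be rational, but the fibre over a closed point is closed and so
  -- contains a rational point.
  obtain ⟨r, hrW, hr⟩ := exists_pt_mem (hW.inter
    ((isClosed_pt (lift y z)).preimage (Scheme.Hom.continuous φ.left))).isLocallyClosed ⟨v, hvW, hv⟩
  obtain ⟨a, c, rfl⟩ := hlift r
  have h := pt_injective ((hφ a c).symm.trans hr)
  obtain rfl : a = y := by simpa using congr($h ≫ fst _ _)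
  exact ⟨c, ((hmemW a c).mp hrW).2, by simpa using congr($h ≫ snd _ _)⟩

end AlgebraicSemigroup

end AlgSemigroups

theorem mainTheorem12 {k : Type u} [Field k] [IsAlgClosed k]
    (G : AlgSemigroups.AlgebraicSemigroup k) (hG : Nonempty G.S.left) :
    ∃ e : G.Point, G.IsIdempotent e := by
  have := G.isVariety.locallyOfFiniteType
  have := G.noetherianSpace_point
  have := G.t1Space_point
  obtain ⟨p, -⟩ := AlgSemigroups.exists_pt_mem (X := G.S) isClosed_univ.isLocallyClosed
    (@Set.univ_nonempty _ hG)
  have : Nonempty G.Point := ⟨p⟩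
  exact AlgSemigroups.exists_isIdempotentElem_of_dense_translates G.continuous_mul_left
    G.continuous_mul_right fun _ => G.exists_open_dvd
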